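/- Let $X$ be a topologically complete space, i.e. a Tychonoff space that is complete in its finest uniformity. A closed locally finite cover $\alpha$ of $X$ is called normal if there is a partition of unity $\{\phi_{\alpha,V} : V\in\alpha\}$ on $X$ with $\mathrm{cl}(\phi_{\alpha,V}^{-1}((0,1]))\subset \mathrm{int}(V)$ for each $V\in\alpha$. Let $\mathcal A$ be a family of closed, locally finite, normal covers of $X$ such that I) for each open $U\subset X$ and each $x\in U$ there is $\alpha\in\mathcal A$ with $\bigcup\{V\in\alpha : x\in V\}\subset U$; II) whenever a member $f(\alpha)\in\alpha$ is selected for each $\alpha\in\mathcal A$ and $\{f(\alpha)\}_{\alpha\in\mathcal A}$ has the finite intersection property, then $\bigcap_{\alpha\in\mathcal A}f(\alpha)\neq\emptyset$. Let $\Lambda$ be the set of all finite subsets of $\mathcal A$, ordered by inclusion. For $\lambda=\{\alpha_1,\dots,\alpha_n\}\in\Lambda$ let $N^{(0)}_\lambda$ be the set of all $v=(V_1,\dots,V_n)\in\alpha_1\times\dots\times\alpha_n$ such that $\wedge v:=V_1\cap\dots\cap V_n\neq\emptyset$ (the empty intersection being $X$). Let $F_\lambda$ and $N_\lambda$ be the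 simplicial complexes, with the weak topology, on the vertex set $N^{(0)}_\lambda$, in which a finite non-empty set $\{v_1,\dots,v_k\}$ of vertices spans a simplex of $F_\lambda$ iff $\wedge v_i\cap\wedge v_j\neq\emptyset$ for all $i,j$, and spans a simplex of $N_\lambda$ iff $\wedge v_1\cap\dots\cap\wedge v_k\neq\emptyset$. For a point $a$ of $F_\lambda$ let $\wedge a$ be the intersection of the sets $\wedge v$ over the vertices $v$ of the simplex having $a$ in its interior. For $\lambda\subset\mu$, forgetting the coordinates outside $\lambda$ defines simplicial maps $\pi^\mu_\lambda:F_\mu\to F_\lambda$ and $\pi^\mu_\lambda:N_\mu\to N_\lambda$. Let $F_\infty=\varprojlim (F_\lambda,\pi^\mu_\lambda;\Lambda)$ and $N_\infty=\varprojlim (N_\lambda,\pi^\mu_\lambda;\Lambda)$. Then $N_\infty=F_\infty$ (the inclusions $N_\lambda\subset F_\lambda$ induce a homeomorphism $N_\infty\to F_\infty$), and for each thread $z=(z(\lambda))_\lambda$ the set $\bigcap_{\lambda\in\Lambda}\wedge z(\lambda)$ consists of exactly one point, denoted $\pi(z)$. Moreover: (1) The map $\pi:N_\infty\to X$ is perfect: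 $N_\infty$ is Hausdorff and $\pi$ is continuous and closed with compact fibers. (2) For each $\alpha\in\mathcal A$ let $\{\phi_{\alpha,V}\}_{V\in\alpha}$ be any partition of unity as above. For $\lambda\in\Lambda$ let $p_\lambda:X\to N_\lambda$ be the map whose barycentric coordinate at the vertex $v=(V_1,\dots,V_n)$ is $\phi_{\alpha_1,V_1}\cdots\phi_{\alpha_n,V_n}$. These maps induce a continuous limit map $p:X\to N_\infty$ such that (2a) $\pi\circ p=\mathrm{id}_X$; (2b) there is a homotopy $H:N_\infty\times[0,1]\to N_\infty$ with $H_0=\mathrm{id}_{N_\infty}$, $H_1=p\circ\pi$ and $\pi\circ H=\pi\circ\mathrm{proj}$, where $\mathrm{proj}:N_\infty\times[0,1]\to N_\infty$ is the projection. In particular each fiber of $\pi$ is contractible, and $\pi$ is a homotopy equivalence with homotopy inverse $p$, so $N_\infty\simeq X$. -/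

import Mathlib

universe u v

namespace CoverLimit

section Covers

variable {X : Type u} [TopologicalSpace X]

/-- A topologically complete space: a Tychonoff space that is complete in its finest (compatible)
uniformity. In Mathlib's order on `UniformSpace X`, `u ≤ u'` means that `u` is finer than `u'`. -/
structure TopologicallyComplete (X : Type u) [t : TopologicalSpace X] : Prop where
  tychonoff : T35Space X
  complete : ∃ u : UniformSpace X,
    IsLeast {u' : UniformSpace X | u'.toTopologicalSpace = t} u ∧ @CompleteSpace X u

/-- A partition of unity indexed by the members of the cover `α`, the closed support of the function
with index `V` being contained in the interior of `V`. -/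
def SubordinateTo (α : Set (Set X)) (φ : PartitionOfUnity α X) : Prop :=
  φ.IsSubordinate fun V => interior (V : Set X)

/-- Closed, locally finite, normal covers. -/
structure IsClosedNormalCover (α : Set (Set X)) : Prop where
  cover : ⋃₀ α = Set.univ
  closed : ∀ V ∈ α, IsClosed V
  locallyFinite : LocallyFinite fun V : α => (V : Set X)
  normal : ∃ φ : PartitionOfUnity α X, SubordinateTo α φ

/-- `star α S` is the set of members of `α` that meet `S`. -/
def star (α : Set (Set X)) (S : Set X) : Set (Set X) :=
  {V | V ∈ α ∧ (S ∩ V).Nonempty}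

/-- Condition I), local refinement. -/
def LocalRefinement (A : Set (Set (Set X))) : Prop :=
  ∀ U : Set X, IsOpen U → ∀ x ∈ U, ∃ α ∈ A, ⋃₀ star α {x} ⊆ U

/-- Condition II), completeness: a selection of one member of each cover that has the finite
intersection property has a common point. -/
def SelectionComplete (A : Set (Set (Set X))) : Prop :=
  ∀ f : A → Set X, (∀ α : A, f α ∈ (α : Set (Set X))) →
    (∀ L : Finset A, (⋂ α ∈ L, f α).Nonempty) → (⋂ α, f α).Nonempty

end Covers

section Realization

/-- A map of vertex sets that sends (the vertices of) simplices onto simplices. -/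
def IsSimplicial {V W : Type u} (K : AbstractSimplicialComplex V)
    (M : AbstractSimplicialComplex W) (f : V → W) : Prop :=
  ∀ s ∈ K.faces, ∃ t ∈ M.faces, (t : Set W) = f '' (s : Set V)

/-- The points of the geometric realization of an abstract simplicial complex, given by
barycentric coordinates. -/
@[ext]
structure Realization {V : Type u} (K : AbstractSimplicialComplex V) where
  /-- the barycentric coordinates -/
  coord : V →₀ ℝ
  nonneg : ∀ v, 0 ≤ coord v
  sum_eq_one : coord.sum (fun _ r => r) = 1
  support_mem : coord.support ∈ K.faces

namespace Realization

variable {V W : Type u} {K : AbstractSimplicialComplex V} {M : AbstractSimplicialComplex W}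

/-- The closed simplex spanned by a finite set of vertices. -/
def simplex (K : AbstractSimplicialComplex V) (s : Finset V) : Set (Realization K) :=
  {a | a.coord.support ⊆ s}

/-- The Euclidean topology of a closed simplex: convergence of all barycentric coordinates. -/
abbrev simplexTopology (K : AbstractSimplicialComplex V) (s : Finset V) :
    TopologicalSpace (simplex K s) :=
  TopologicalSpace.induced (fun a v => a.1.coord v)
    (inferInstance : TopologicalSpace (V → ℝ))

/-- The weak topology: the finest one for which the inclusions of all closed simplices, with
their Euclidean topologies, are continuous. -/
instance instTopologicalSpace (K : AbstractSimplicialComplex V) :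
    TopologicalSpace (Realization K) :=
  ⨆ s : {s : Finset V // s ∈ K.faces},
    TopologicalSpace.coinduced (Subtype.val : simplex K s.1 → Realization K)
      (simplexTopology K s.1)

theorem mem_faces_of_subset {s t : Finset V} (hs : s ∈ K.faces) (hts : t ⊆ s)
    (ht : t.Nonempty) : t ∈ K.faces :=
  (K.isRelLowerSet_faces hs).2 hts ht

/-- The map of realizations induced by a simplicial map: it is affine on each simplex. -/
noncomputable def map (f : V → W) (hf : IsSimplicial K M f) (a : Realization K) :
    Realization M where
  coord := a.coord.mapDomain f
  nonneg w := by
    classical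
    rw [Finsupp.mapDomain, Finsupp.sum_apply]
    refine Finset.sum_nonneg fun v _ => ?_
    change 0 ≤ Finsupp.single (f v) (a.coord v) w
    rw [Finsupp.single_apply]
    split_ifs
    · exact a.nonneg v
    · exact le_rfl
  sum_eq_one := by
    rw [Finsupp.sum_mapDomain_index (fun _ => rfl) (fun _ _ _ => rfl)]
    exact a.sum_eq_one
  support_mem := by
    classical
    obtain ⟨t, ht, hts⟩ := hf _ a.support_mem
    refine mem_faces_of_subset ht ?_ ?_
    · intro w hw
      have h := Finsupp.mapDomain_support hw
      rw [← Finset.mem_coe, hts]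
      simpa using h
    · rw [Finsupp.support_nonempty_iff]
      intro h
      have h1 : (a.coord.mapDomain f).sum (fun _ r => r) = 1 := by
        rw [Finsupp.sum_mapDomain_index (fun _ => rfl) (fun _ _ _ => rfl)]
        exact a.sum_eq_one
      rw [h, Finsupp.sum_zero_index] at h1
      exact zero_ne_one h1

/-- The inclusion of a subcomplex with the same vertex set. -/
def incl {K K' : AbstractSimplicialComplex V} (h : K.faces ⊆ K'.faces) (a : Realization K) :
    Realization K' :=
  ⟨a.coord, a.nonneg, a.sum_eq_one, h a.support_mem⟩

end Realization

end Realization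

section System

variable {X : Type u} {A : Set (Set (Set X))}

/-- The vertices at the finite subset `L` of `A`: choices of one member of each cover in `L`, with
non-empty intersection. -/
@[ext]
structure Vertex (A : Set (Set (Set X))) (L : Finset A) where
  /-- the chosen member of each cover in `L` -/
  choice : ∀ α : L, (α.1.1 : Set (Set X))
  nonempty : (⋂ α : L, (choice α : Set X)).Nonempty

/-- The intersection of the members chosen by a vertex. -/
def Vertex.wedge {L : Finset A} (v : Vertex A L) : Set X :=
  ⋂ α : L, (v.choice α : Set X)

/-- The projection of vertices that forgets the covers outside `L`. -/
def Vertex.proj {L M : Finset A} (h : L ≤ M) (v : Vertex A M) : Vertex A L where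
  choice α := v.choice ⟨α.1, h α.2⟩
  nonempty := v.nonempty.mono
    (Set.subset_iInter fun α => Set.iInter_subset _ (⟨α.1, h α.2⟩ : M))

theorem Vertex.wedge_subset_proj {L M : Finset A} (h : L ≤ M) (v : Vertex A M) :
    v.wedge ⊆ (v.proj h).wedge :=
  Set.subset_iInter fun α => Set.iInter_subset _ (⟨α.1, h α.2⟩ : M)

/-- The flag complex `F_L`: a finite set of vertices spans a simplex iff its vertices have pairwise
intersecting wedges. -/
def flagComplex (A : Set (Set (Set X))) (L : Finset A) :
    AbstractSimplicialComplex (Vertex A L) where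
  faces := {s | s.Nonempty ∧ ∀ v ∈ s, ∀ w ∈ s, (v.wedge ∩ w.wedge).Nonempty}
  isRelLowerSet_faces := fun _ hs => ⟨hs.1, fun _ hts ht =>
    ⟨ht, fun v hv w hw => hs.2 v (hts hv) w (hts hw)⟩⟩
  singleton_mem v := ⟨Finset.singleton_nonempty v, fun a ha b hb => by
    rw [Finset.mem_singleton.1 ha, Finset.mem_singleton.1 hb, Set.inter_self]
    exact v.nonempty⟩

/-- The complex `N_L`: a finite set of vertices spans a simplex iff the wedges of its vertices
have a common point. -/
def nerveComplex (A : Set (Set (Set X))) (L : Finset A) :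
    AbstractSimplicialComplex (Vertex A L) where
  faces := {s | s.Nonempty ∧ (⋂ v ∈ s, v.wedge).Nonempty}
  isRelLowerSet_faces := fun _ hs => ⟨hs.1, fun _ hts ht =>
    ⟨ht, hs.2.mono (Set.biInter_subset_biInter_left hts)⟩⟩
  singleton_mem v := ⟨Finset.singleton_nonempty v, by
    rw [Finset.set_biInter_singleton]
    exact v.nonempty⟩

theorem nerve_subset_flag (A : Set (Set (Set X))) (L : Finset A) :
    (nerveComplex A L).faces ⊆ (flagComplex A L).faces := by
  rintro s ⟨hs, x, hx⟩
  rw [Set.mem_iInter₂] at hx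
  exact ⟨hs, fun v hv w hw => ⟨x, hx v hv, hx w hw⟩⟩

theorem proj_simplicial_flag {L M : Finset A} (h : L ≤ M) :
    IsSimplicial (flagComplex A M) (flagComplex A L) (Vertex.proj h) := by
  classical
  rintro s ⟨hs, hs'⟩
  refine ⟨s.image (Vertex.proj h), ⟨hs.image _, ?_⟩, Finset.coe_image⟩
  intro v' hv' w' hw'
  obtain ⟨v, hv, rfl⟩ := Finset.mem_image.1 hv'
  obtain ⟨w, hw, rfl⟩ := Finset.mem_image.1 hw'
  exact (hs' v hv w hw).mono
    (Set.inter_subset_inter (v.wedge_subset_proj h) (w.wedge_subset_proj h))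

theorem proj_simplicial_nerve {L M : Finset A} (h : L ≤ M) :
    IsSimplicial (nerveComplex A M) (nerveComplex A L) (Vertex.proj h) := by
  classical
  rintro s ⟨hs, x, hx⟩
  refine ⟨s.image (Vertex.proj h), ⟨hs.image _, x, ?_⟩, Finset.coe_image⟩
  rw [Set.mem_iInter₂] at hx ⊢
  intro v' hv'
  obtain ⟨v, hv, rfl⟩ := Finset.mem_image.1 hv'
  exact v.wedge_subset_proj h (hx v hv)

/-- The bonding map `F_M → F_L` for `L ≤ M`. -/
noncomputable def flagBond {L M : Finset A} (h : L ≤ M) :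
    Realization (flagComplex A M) → Realization (flagComplex A L) :=
  Realization.map (Vertex.proj h) (proj_simplicial_flag h)

/-- The bonding map `N_M → N_L` for `L ≤ M`. -/
noncomputable def nerveBond {L M : Finset A} (h : L ≤ M) :
    Realization (nerveComplex A M) → Realization (nerveComplex A L) :=
  Realization.map (Vertex.proj h) (proj_simplicial_nerve h)

/-- The inverse limit `F_∞`: the space of threads, as a subspace of the product. -/
abbrev FlagLimit (A : Set (Set (Set X))) : Type u :=
  {z : ∀ L : Finset A, Realization (flagComplex A L) //
    ∀ (L M : Finset A) (h : L ≤ M), flagBond h (z M) = z L}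

/-- The inverse limit `N_∞`: the space of threads, as a subspace of the product. -/
abbrev NerveLimit (A : Set (Set (Set X))) : Type u :=
  {z : ∀ L : Finset A, Realization (nerveComplex A L) //
    ∀ (L M : Finset A) (h : L ≤ M), nerveBond h (z M) = z L}

/-- The natural map `N_∞ → F_∞` induced by the inclusions `N_L ⊆ F_L`. -/
def limitIncl (A : Set (Set (Set X))) (z : NerveLimit A) : FlagLimit A :=
  ⟨fun L => Realization.incl (nerve_subset_flag A L) (z.1 L), fun L M h =>
    Realization.ext (congrArg (fun a => a.coord) (z.2 L M h) : _)⟩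

/-- The subset `∧a` of `X` for a point `a` of a complex on the vertices at `L`: the intersection of
the wedges of the vertices of the unique simplex that has `a` in its interior. -/
def pointWedge {L : Finset A} {K : AbstractSimplicialComplex (Vertex A L)}
    (a : Realization K) : Set X :=
  ⋂ v ∈ a.coord.support, v.wedge

end System

section Maps

/-- Perfect maps: continuous closed maps with compact fibers, defined on a Hausdorff space. -/
structure IsPerfectMap {Y Z : Type*} [TopologicalSpace Y] [TopologicalSpace Z]
    (f : Y → Z) : Prop where
  t2 : T2Space Y
  continuous : Continuous f
  closed : IsClosedMap f
  compact_fiber : ∀ z, IsCompact (f ⁻¹' {z})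

/-- `p : X → N_∞` is the limit of the canonical maps `p_L : X → N_L` of the partitions of unity
`φ_v = ∏ α ∈ L, φ_{α, v α}`: the barycentric coordinate of `p_L x` at the vertex `v` is `φ_v x`. -/
def IsLimitOfCanonicalMaps {X : Type u} [TopologicalSpace X] {A : Set (Set (Set X))}
    (Φ : ∀ α : A, PartitionOfUnity (α : Set (Set X)) X) (p : X → NerveLimit A) : Prop :=
  ∀ (x : X) (L : Finset A) (v : Vertex A L),
    ((p x).1 L).coord v = ∏ α : L, Φ α.1 (v.choice α) x

end Maps

end CoverLimit

/-! A thread of flag complexes has finite non-empty supports at every level, so compactness gives a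
coherent choice of vertices, and condition II) yields a point `x` common to the chosen members.
Closedness of the covers and condition I) put `x` in every wedge of every support, and I) also makes
it unique (`FlagLimit.iInter_pointWedge`). A common point turns each flag simplex of the thread into
a nerve simplex, so the two limits have the same points. I) makes `x` depend continuously on the
thread (`LocalRefinement.continuous`).

Local finiteness controls the weak topology. At each level, all threads over points near `x` have
coordinates supported in the single finite simplex `vertices x L` (`eventually_mem_simplex`), where
the topology is that of barycentric coordinates. Compactness of these simplices gives properness of
`π` (`isProperMap`). Continuity into the limit can be checked on coordinates
(`continuous_of_coord`), which handles both `p` and the straight-line homotopy from the identity to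
`p ∘ π`; the latter exists because `z` and `p (π z)` lie in the simplices of `π z`. -/

namespace CoverLimit

open Filter Topology

/-! ### Weak topology and simplicial maps on geometric realizations. -/

namespace Realization

variable {V W : Type u} {K : AbstractSimplicialComplex V} {M : AbstractSimplicialComplex W}

theorem mem_support {a : Realization K} {v : V} : v ∈ a.coord.support ↔ 0 < a.coord v := by
  rw [Finsupp.mem_support_iff]
  exact ⟨fun h => (a.nonneg v).lt_of_ne' h, ne_of_gt⟩

theorem support_nonempty (a : Realization K) : a.coord.support.Nonempty :=
  (K.isRelLowerSet_faces a.support_mem).1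

theorem coord_eq_zero_of_mem_simplex {s : Finset V} {a : Realization K} (ha : a ∈ simplex K s)
    {v : V} (hv : v ∉ s) : a.coord v = 0 :=
  Finsupp.notMem_support_iff.1 fun h => hv (ha h)

theorem sum_coord_of_mem_simplex {s : Finset V} {a : Realization K} (ha : a ∈ simplex K s) :
    ∑ v ∈ s, a.coord v = 1 := by
  rw [← a.sum_eq_one, Finsupp.sum_of_support_subset _ ha _ fun _ _ => rfl]

/-- The point of the simplex `s` with given barycentric coordinates. -/
noncomputable def ofFace (s : Finset V) (hs : s ∈ K.faces) (c : V → ℝ) (h0 : ∀ v, 0 ≤ c v)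
    (hc : ∀ v, c v ≠ 0 → v ∈ s) (h1 : ∑ v ∈ s, c v = 1) : Realization K where
  coord := Finsupp.onFinset s c hc
  nonneg := h0
  sum_eq_one := by
    rw [Finsupp.sum_of_support_subset _ Finsupp.support_onFinset_subset _ fun _ _ => rfl]
    exact h1
  support_mem := by
    refine mem_faces_of_subset hs Finsupp.support_onFinset_subset ?_
    obtain ⟨v, -, hv⟩ := Finset.exists_ne_zero_of_sum_ne_zero (h1.trans_ne one_ne_zero)
    exact ⟨v, Finsupp.mem_support_iff.2 hv⟩

@[simp]
theorem ofFace_coord (s : Finset V) (hs : s ∈ K.faces) (c : V → ℝ) (h0 : ∀ v, 0 ≤ c v)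
    (hc : ∀ v, c v ≠ 0 → v ∈ s) (h1 : ∑ v ∈ s, c v = 1) (v : V) :
    (ofFace s hs c h0 hc h1).coord v = c v := rfl

theorem ofFace_mem_simplex (s : Finset V) (hs : s ∈ K.faces) (c : V → ℝ) (h0 : ∀ v, 0 ≤ c v)
    (hc : ∀ v, c v ≠ 0 → v ∈ s) (h1 : ∑ v ∈ s, c v = 1) :
    ofFace s hs c h0 hc h1 ∈ simplex K s :=
  Finsupp.support_onFinset_subset (hf := hc)

theorem continuous_coord (v : V) : Continuous fun a : Realization K => a.coord v := by
  refine continuous_iSup_dom.2 fun s => continuous_coinduced_dom.2 ?_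
  let _ := simplexTopology K s.1
  exact (continuous_apply v).comp
    (continuous_induced_dom (f := fun a : simplex K s.1 => ⇑a.1.coord))

instance : T2Space (Realization K) :=
  T2Space.of_injective_continuous (f := fun a : Realization K => ⇑a.coord)
    (fun _ _ h => Realization.ext (DFunLike.coe_injective h))
    (continuous_pi continuous_coord)

/-- Within a single simplex, convergence of the barycentric coordinates implies convergence. -/
theorem tendsto_of_tendsto_coord {Y : Type*} {l : Filter Y} {g : Y → Realization K}
    {a : Realization K} {s : Finset V} (hs : s ∈ K.faces) (ha : a ∈ simplex K s)
    (hg : ∀ᶠ y in l, g y ∈ simplex K s)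
    (h : ∀ v, Tendsto (fun y => (g y).coord v) l (𝓝 (a.coord v))) : Tendsto g l (𝓝 a) := by
  refine tendsto_nhds.2 fun U hU haU => ?_
  -- The weak topology is final, so the trace of `U` on the simplex `s` is cut out by an open set
  -- `O` of coordinate functions.
  have hU' := isOpen_coinduced.1 ((isOpen_iSup_iff.1 hU) ⟨s, hs⟩)
  obtain ⟨O, hO, hOU⟩ := isOpen_induced_iff.1 hU'
  have hmem : ∀ b (hb : b ∈ simplex K s), (⇑b.coord ∈ O ↔ b ∈ U) := fun b hb => by
    have := Set.ext_iff.1 hOU ⟨b, hb⟩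
    exact this
  have ht : Tendsto (fun y => ⇑(g y).coord) l (𝓝 ⇑a.coord) := tendsto_pi_nhds.2 h
  filter_upwards [hg, ht (hO.mem_nhds ((hmem a ha).2 haU))] with y hy hy'
  exact (hmem _ hy).1 hy'

theorem continuousAt_of_coord {Y : Type*} [TopologicalSpace Y] {g : Y → Realization K} {y : Y}
    {s : Finset V} (hs : s ∈ K.faces) (hg : ∀ᶠ y' in 𝓝 y, g y' ∈ simplex K s)
    (h : ∀ v, ContinuousAt (fun y => (g y).coord v) y) : ContinuousAt g y :=
  tendsto_of_tendsto_coord hs hg.self_of_nhds hg h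

/-- Closed simplices are compact. -/
theorem exists_tendsto_of_mem_simplex {Y : Type*} (𝒰 : Ultrafilter Y) {g : Y → Realization K}
    {s : Finset V} (hs : s ∈ K.faces) (hg : ∀ᶠ y in (𝒰 : Filter Y), g y ∈ simplex K s) :
    ∃ a ∈ simplex K s, Tendsto g 𝒰 (𝓝 a) := by
  -- Each coordinate lies in the compact interval `[0, 1]`, so it converges along the ultrafilter.
  -- Sums over the finite set `s` pass to the limit, so the limits are barycentric coordinates
  -- again.
  have hlim : ∀ v, ∃ r : ℝ, Tendsto (fun y => (g y).coord v) 𝒰 (𝓝 r) := by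
    intro v
    have hmem : ∀ y, (g y).coord v ∈ Set.Icc (0 : ℝ) 1 := by
      refine fun y => ⟨(g y).nonneg v, ?_⟩
      by_cases hv : v ∈ (g y).coord.support
      · rw [← (g y).sum_eq_one]
        exact Finset.single_le_sum (f := fun v => (g y).coord v) (fun w _ => (g y).nonneg w) hv
      · rw [Finsupp.notMem_support_iff.1 hv]
        exact zero_le_one
    obtain ⟨r, -, hr⟩ := (isCompact_Icc (a := (0 : ℝ)) (b := 1)).ultrafilter_le_nhds
      (𝒰.map fun y => (g y).coord v) (by
        rw [le_principal_iff]
        exact Filter.mem_map.2 (Filter.univ_mem' hmem))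
    exact ⟨r, hr⟩
  choose c hc using hlim
  have hzero : ∀ v, c v ≠ 0 → v ∈ s := by
    intro v
    refine not_imp_comm.1 fun hv => tendsto_nhds_unique (hc v) ?_
    refine tendsto_const_nhds.congr' ?_
    filter_upwards [hg] with y hy
    exact (coord_eq_zero_of_mem_simplex hy hv).symm
  have hsum : ∑ v ∈ s, c v = 1 := by
    refine tendsto_nhds_unique (tendsto_finsetSum s fun v _ => hc v) ?_
    refine tendsto_const_nhds.congr' ?_
    filter_upwards [hg] with y hy
    exact (sum_coord_of_mem_simplex hy).symm
  have ha := ofFace_mem_simplex s hs c (fun v => ge_of_tendsto' (hc v) fun y => (g y).nonneg v)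
    hzero hsum
  exact ⟨_, ha, tendsto_of_tendsto_coord hs ha hg hc⟩

theorem continuous_of_simplexwise {f : Realization K → Realization M}
    (h : ∀ s ∈ K.faces, ∃ t ∈ M.faces, Set.MapsTo f (simplex K s) (simplex M t) ∧
      ∀ w, ∃ g : (V → ℝ) → ℝ, Continuous g ∧ ∀ a ∈ simplex K s, (f a).coord w = g a.coord) :
    Continuous f := by
  refine continuous_iSup_dom.2 fun s => continuous_coinduced_dom.2 ?_
  obtain ⟨t, ht, hst, hg⟩ := h s.1 s.2
  let _ := simplexTopology K s.1
  refine continuous_iff_continuousAt.2 fun a =>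
    continuousAt_of_coord ht (Eventually.of_forall fun b => hst b.2) fun w => ?_
  obtain ⟨g, hg, hfg⟩ := hg w
  have hc : Continuous fun a : simplex K s.1 => g a.1.coord :=
    hg.comp (continuous_induced_dom (f := fun a : simplex K s.1 => ⇑a.1.coord))
  refine Continuous.continuousAt ?_
  convert hc using 2 with b
  exact hfg b.1 b.2

theorem continuous_incl {K' : AbstractSimplicialComplex V} (h : K.faces ⊆ K'.faces) :
    Continuous (incl h) :=
  continuous_of_simplexwise fun s hs => ⟨s, h hs, fun _ ha => ha, fun w =>
    ⟨fun c => c w, continuous_apply w, fun _ _ => rfl⟩⟩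

section Map

variable {f : V → W} {hf : IsSimplicial K M f}

theorem map_coord_apply [DecidableEq W] {s : Finset V} {a : Realization K}
    (ha : a ∈ simplex K s) (w : W) :
    (map f hf a).coord w = ∑ v ∈ s with f v = w, a.coord v := by
  change (a.coord.mapDomain f) w = _
  rw [Finsupp.mapDomain, Finsupp.sum_of_support_subset _ ha _ fun _ _ => Finsupp.single_zero _,
    Finsupp.finsetSum_apply, Finset.sum_filter]
  exact Finset.sum_congr rfl fun v _ => Finsupp.single_apply

/-- Coordinates are nonnegative, so nothing cancels when they are added along a fibre of `f`. This
allows vertices in the support of a thread to be lifted to higher levels. -/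
theorem mem_support_map {a : Realization K} {w : W} :
    w ∈ (map f hf a).coord.support ↔ ∃ v ∈ a.coord.support, f v = w := by
  classical
  rw [mem_support, map_coord_apply (s := a.coord.support) (fun _ h => h),
    Finset.sum_pos_iff_of_nonneg fun v _ => a.nonneg v]
  simp only [Finset.mem_filter, and_assoc]
  exact ⟨fun ⟨v, h, h', _⟩ => ⟨v, h, h'⟩, fun ⟨v, h, h'⟩ => ⟨v, h, h', mem_support.1 h⟩⟩

theorem continuous_map : Continuous (map f hf) := by
  classical
  refine continuous_of_simplexwise fun s hs => ?_
  obtain ⟨t, ht, hts⟩ := hf s hs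
  refine ⟨t, ht, fun a ha w hw => ?_, fun w => ⟨fun c => ∑ v ∈ s with f v = w, c v,
    continuous_finsetSum _ fun v _ => continuous_apply v, fun a ha => map_coord_apply ha w⟩⟩
  obtain ⟨v, hv, rfl⟩ := mem_support_map.1 hw
  rw [← Finset.mem_coe, hts]
  exact ⟨v, ha hv, rfl⟩

end Map

end Realization

/-! ### Threads: coherent choice of vertices and comparison of the two limits. -/

variable {X : Type u} {A : Set (Set (Set X))}

theorem Vertex.mem_wedge {L : Finset A} {v : Vertex A L} {x : X} :
    x ∈ v.wedge ↔ ∀ α : L, x ∈ (v.choice α : Set X) := Set.mem_iInter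

theorem mem_pointWedge {L : Finset A} {K : AbstractSimplicialComplex (Vertex A L)}
    {a : Realization K} {x : X} :
    x ∈ pointWedge a ↔ ∀ v ∈ a.coord.support, x ∈ v.wedge := Set.mem_iInter₂

theorem mem_iInter_pointWedge {K : ∀ L : Finset A, AbstractSimplicialComplex (Vertex A L)}
    {z : ∀ L : Finset A, Realization (K L)} {x : X} :
    x ∈ ⋂ L, pointWedge (z L) ↔ ∀ L, ∀ v ∈ (z L).coord.support, x ∈ v.wedge := by
  simp only [Set.mem_iInter, mem_pointWedge]

/-- In a thread of the flag complexes, a vertex can be selected consistently. -/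
theorem FlagLimit.exists_selection (z : FlagLimit A) :
    ∃ w : ∀ L : Finset A, Vertex A L, (∀ L, w L ∈ (z.1 L).coord.support) ∧
      ∀ L (α : A) (h : α ∈ L), (w L).choice ⟨α, h⟩ =
        (w {α}).choice ⟨α, Finset.mem_singleton_self α⟩ := by
  classical
  choose v hv using fun M => (z.1 M).support_nonempty
  -- The vertices `v M` need not be compatible. For fixed `L` their projections lie in the finite
  -- support of `z L`, so an ultrafilter finer than `atTop` selects one value `w L`.
  let 𝒰 : Ultrafilter (Finset A) := Ultrafilter.of atTop
  have key : ∀ L, ∃ w ∈ (↑(z.1 L).coord.support : Set (Vertex A L)),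
      ∀ᶠ M in (𝒰 : Filter (Finset A)), ∃ h : L ≤ M, (v M).proj h = w := by
    intro L
    refine (Ultrafilter.eventually_exists_mem_iff (Finset.finite_toSet _)).1 ?_
    filter_upwards [Ultrafilter.of_le atTop (eventually_ge_atTop L)] with M hM
    refine ⟨(v M).proj hM, ?_, hM, rfl⟩
    rw [← z.2 L M hM]
    exact Realization.mem_support_map.2 ⟨v M, hv M, rfl⟩
  choose w hw hwv using key
  refine ⟨w, hw, fun L α h => ?_⟩
  -- Both `w L` and `w {α}` are projections of `v M` for a common `M`.
  obtain ⟨M, ⟨h1, h2⟩, h3, h4⟩ := ((hwv L).and (hwv {α})).exists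
  rw [← h2, ← h4]
  rfl

theorem continuous_limitIncl : Continuous (limitIncl A) :=
  Continuous.subtype_mk (continuous_pi fun L =>
    (Realization.continuous_incl (nerve_subset_flag A L)).comp
      ((continuous_apply L).comp continuous_subtype_val)) _

theorem limitIncl_injective : Function.Injective (limitIncl A) := fun _ _ h =>
  Subtype.ext <| funext fun L => Realization.ext <|
    congrArg (fun y : FlagLimit A => (y.1 L).coord) h

theorem limitIncl_surjective {q : FlagLimit A → X}
    (hq : ∀ z L, ∀ v ∈ (z.1 L).coord.support, q z ∈ v.wedge) :
    Function.Surjective (limitIncl A) := fun z => by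
  refine ⟨⟨fun L => ⟨(z.1 L).coord, (z.1 L).nonneg, (z.1 L).sum_eq_one,
    (z.1 L).support_nonempty, q z, Set.mem_iInter₂.2 fun v hv => hq z L v hv⟩, fun L M h =>
    Realization.ext (congrArg (fun a => a.coord) (z.2 L M h) :)⟩, rfl⟩

theorem continuous_nerveLimit_coord (L : Finset A) (v : Vertex A L) :
    Continuous fun z : NerveLimit A => (z.1 L).coord v :=
  (Realization.continuous_coord v).comp ((continuous_apply L).comp continuous_subtype_val)

/-! ### The point determined by a thread, and its continuity. -/

variable [TopologicalSpace X]

theorem LocalRefinement.eq_of_forall_exists [T1Space X] (hI : LocalRefinement A) {x y : X}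
    (h : ∀ α ∈ A, ∃ V ∈ α, x ∈ V ∧ y ∈ V) : x = y := by
  by_contra hxy
  obtain ⟨α, hα, hs⟩ := hI {y}ᶜ isOpen_compl_singleton x hxy
  obtain ⟨V, hV, hx, hy⟩ := h α hα
  exact hs ⟨V, ⟨hV, x, rfl, hx⟩, hy⟩ rfl

theorem LocalRefinement.eq_of_forall_mem_wedge [T1Space X] (hI : LocalRefinement A)
    {K : ∀ L : Finset A, AbstractSimplicialComplex (Vertex A L)}
    {z : ∀ L : Finset A, Realization (K L)} {x y : X}
    (hx : ∀ L, ∀ v ∈ (z L).coord.support, x ∈ v.wedge)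
    (hy : ∀ L, ∀ v ∈ (z L).coord.support, y ∈ v.wedge) : x = y := by
  refine hI.eq_of_forall_exists fun α hα => ?_
  obtain ⟨v, hv⟩ := (z {⟨α, hα⟩}).support_nonempty
  let i : ({⟨α, hα⟩} : Finset A) := ⟨⟨α, hα⟩, Finset.mem_singleton_self _⟩
  exact ⟨v.choice i, (v.choice i).2, Vertex.mem_wedge.1 (hx _ v hv) i,
    Vertex.mem_wedge.1 (hy _ v hv) i⟩

/-- For each thread of the flag complexes, the wedges of all its points have a single common
point. -/
theorem FlagLimit.iInter_pointWedge [T1Space X] (hA : ∀ α ∈ A, ∀ V ∈ α, IsClosed V)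
    (hI : LocalRefinement A) (hII : SelectionComplete A) (z : FlagLimit A) :
    ∃ x : X, ⋂ L : Finset A, pointWedge (z.1 L) = {x} := by
  classical
  obtain ⟨w, hw, hws⟩ := z.exists_selection
  let f : A → Set X := fun α => (w {α}).choice ⟨α, Finset.mem_singleton_self α⟩
  have hf : ∀ L α (h : α ∈ L), ((w L).choice ⟨α, h⟩ : Set X) = f α := fun L α h =>
    congrArg Subtype.val (hws L α h)
  obtain ⟨x, hx⟩ := hII f (fun α => Subtype.prop _) fun L => by
    obtain ⟨y, hy⟩ := (w L).nonempty
    refine ⟨y, Set.mem_iInter₂.2 fun α h => ?_⟩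
    rw [← hf L α h]
    exact Set.mem_iInter.1 hy ⟨α, h⟩
  rw [Set.mem_iInter] at hx
  have hmem : ∀ L, ∀ v ∈ (z.1 L).coord.support, x ∈ v.wedge := by
    intro L v hv
    by_contra hxv
    have hclosed : IsClosed v.wedge :=
      isClosed_iInter fun α => hA _ α.1.2 _ (v.choice α).2
    -- Every member of `α` through `x`, in particular `f a`, misses `v.wedge`. But a lift `v'` of
    -- `v` to `insert a L` meets the selected vertex there by the flag condition, and the
    -- `a`-coordinate of that vertex is `f a`.
    obtain ⟨α, hα, hs⟩ := hI _ hclosed.isOpen_compl x hxv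
    let a : A := ⟨α, hα⟩
    have hLM : L ≤ insert a L := Finset.subset_insert a L
    rw [← z.2 L _ hLM] at hv
    obtain ⟨v', hv', rfl⟩ := Realization.mem_support_map.1 hv
    obtain ⟨y, hy, hyw⟩ := (z.1 (insert a L)).support_mem.2 v' hv' _ (hw (insert a L))
    refine hs ⟨f a, ⟨Subtype.prop _, x, rfl, hx a⟩, ?_⟩ (v'.wedge_subset_proj hLM hy)
    rw [← hf _ a (Finset.mem_insert_self a L)]
    exact Vertex.mem_wedge.1 hyw _
  refine ⟨x, Set.eq_singleton_iff_unique_mem.2 ⟨mem_iInter_pointWedge.2 hmem, fun y hy => ?_⟩⟩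
  exact hI.eq_of_forall_mem_wedge (mem_iInter_pointWedge.1 hy) hmem

/-- A function that assigns to each `y` a common point of the wedges of a family of points
depending continuously on `y` is continuous. -/
theorem LocalRefinement.continuous (hI : LocalRefinement A) {Y : Type*} [TopologicalSpace Y]
    {K : ∀ L : Finset A, AbstractSimplicialComplex (Vertex A L)}
    {g : Y → ∀ L : Finset A, Realization (K L)} (hg : Continuous g) {q : Y → X}
    (hq : ∀ y L, ∀ v ∈ (g y L).coord.support, q y ∈ v.wedge) : Continuous q := by
  refine continuous_iff_continuousAt.2 fun y => tendsto_nhds.2 fun U hU hyU => ?_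
  obtain ⟨α, hα, hs⟩ := hI U hU _ hyU
  let L : Finset A := {⟨α, hα⟩}
  let i : L := ⟨⟨α, hα⟩, Finset.mem_singleton_self _⟩
  obtain ⟨v, hv⟩ := (g y L).support_nonempty
  have hc : Continuous fun y => (g y L).coord v :=
    (Realization.continuous_coord v).comp ((continuous_apply L).comp hg)
  -- Positivity of the coordinate at `v` is an open condition. While it holds, `q y'` stays in the
  -- member of `α` chosen by `v`, which also contains `q y`.
  filter_upwards [hc.continuousAt.eventually (lt_mem_nhds (Realization.mem_support.1 hv))]
    with y' hy'
  refine hs ⟨v.choice i, ⟨(v.choice i).2, q y, rfl, Vertex.mem_wedge.1 (hq y L v hv) i⟩, ?_⟩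
  exact Vertex.mem_wedge.1 (hq y' L v (Realization.mem_support.2 hy')) i

/-! ### Local finiteness: reduction to finite simplices and properness. -/

/-- The covers in `A` are closed and locally finite. -/
structure IsLocallyFiniteSystem (A : Set (Set (Set X))) : Prop where
  cover : ∀ α ∈ A, ⋃₀ α = Set.univ
  closed : ∀ α ∈ A, ∀ V ∈ α, IsClosed V
  locallyFinite : ∀ α ∈ A, LocallyFinite fun V : α => (V : Set X)

namespace IsLocallyFiniteSystem

variable (hA : IsLocallyFiniteSystem A)
include hA

theorem exists_finset_mem (x : X) (α : A) :
    ∃ t : Finset (α : Set (Set X)), ∀ V, V ∈ t ↔ x ∈ (V : Set X) :=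
  ⟨((hA.locallyFinite _ α.2).point_finite x).toFinset, fun _ => Set.Finite.mem_toFinset _⟩

theorem finite_vertices (x : X) (L : Finset A) : {v : Vertex A L | x ∈ v.wedge}.Finite := by
  have h : (Set.pi Set.univ fun α : L => {V : (α.1.1 : Set (Set X)) | x ∈ (V : Set X)}).Finite :=
    Set.Finite.pi fun α => (hA.locallyFinite _ α.1.2).point_finite x
  refine (h.preimage (f := Vertex.choice) fun v _ w _ => Vertex.ext).subset fun v hv => ?_
  exact fun α _ => Vertex.mem_wedge.1 hv α

/-- The vertices at `L` whose wedge contains `x`. -/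
noncomputable def vertices (x : X) (L : Finset A) : Finset (Vertex A L) :=
  (hA.finite_vertices x L).toFinset

theorem mem_vertices {x : X} {L : Finset A} {v : Vertex A L} :
    v ∈ hA.vertices x L ↔ x ∈ v.wedge :=
  Set.Finite.mem_toFinset _

theorem vertices_mem_faces (x : X) (L : Finset A) :
    hA.vertices x L ∈ (nerveComplex A L).faces := by
  have h : ∀ α : L, ∃ V : (α.1.1 : Set (Set X)), x ∈ (V : Set X) := fun α => by
    obtain ⟨V, hV, hx⟩ := Set.sUnion_eq_univ_iff.1 (hA.cover _ α.1.2) x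
    exact ⟨⟨V, hV⟩, hx⟩
  choose c hc using h
  exact ⟨⟨⟨c, x, Set.mem_iInter.2 hc⟩, hA.mem_vertices.2 (Set.mem_iInter.2 hc)⟩, x,
    Set.mem_iInter₂.2 fun v hv => hA.mem_vertices.1 hv⟩

theorem mem_simplex_vertices {x : X} {L : Finset A}
    {K : AbstractSimplicialComplex (Vertex A L)} {a : Realization K} :
    a ∈ Realization.simplex K (hA.vertices x L) ↔ ∀ v ∈ a.coord.support, x ∈ v.wedge :=
  forall₂_congr fun _ _ => hA.mem_vertices

/-- In a locally finite closed family, the members missing `x` all miss some neighbourhood of `x`;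
only the finitely many covers in `L` are involved. -/
theorem eventually_vertices_subset (x : X) (L : Finset A) :
    ∀ᶠ y in 𝓝 x, hA.vertices y L ⊆ hA.vertices x L := by
  have h : ∀ᶠ y in 𝓝 x, ∀ α : L, ∀ V : (α.1.1 : Set (Set X)),
      y ∈ (V : Set X) → x ∈ (V : Set X) := by
    refine eventually_all.2 fun α => ?_
    filter_upwards [(hA.locallyFinite _ α.1.2).iInter_compl_mem_nhds
      (fun V => hA.closed _ α.1.2 V V.2) x] with y hy V hyV
    by_contra hx
    exact Set.mem_iInter₂.1 hy V hx hyV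
  filter_upwards [h] with y hy v hv
  rw [mem_vertices, Vertex.mem_wedge] at hv ⊢
  exact fun α => hy α _ (hv α)

theorem eventually_mem_simplex {Y : Type*} {l : Filter Y} {q : Y → X} {x : X}
    (hq : Tendsto q l (𝓝 x)) {L : Finset A} {K : AbstractSimplicialComplex (Vertex A L)}
    {g : Y → Realization K} (hg : ∀ y, ∀ v ∈ (g y).coord.support, q y ∈ v.wedge) :
    ∀ᶠ y in l, g y ∈ Realization.simplex K (hA.vertices x L) := by
  filter_upwards [hq.eventually (hA.eventually_vertices_subset x L)] with y hy
  exact (hA.mem_simplex_vertices.2 (hg y)).trans hy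

/-- A map into the nerve limit over a continuous map to `X` is continuous as soon as its
barycentric coordinates are. -/
theorem continuous_of_coord {Y : Type*} [TopologicalSpace Y] {q : Y → X} (hq : Continuous q)
    {g : Y → NerveLimit A} (hg : ∀ y L, ∀ v ∈ ((g y).1 L).coord.support, q y ∈ v.wedge)
    (hc : ∀ L v, Continuous fun y => ((g y).1 L).coord v) : Continuous g := by
  refine Continuous.subtype_mk (continuous_pi fun L => continuous_iff_continuousAt.2 fun y => ?_) _
  exact Realization.continuousAt_of_coord (hA.vertices_mem_faces (q y) L)
    (hA.eventually_mem_simplex hq.continuousAt fun y => hg y L) fun v => (hc L v).continuousAt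

theorem isProperMap {π : NerveLimit A → X} (hπ : Continuous π)
    (h : ∀ z, ⋂ L : Finset A, pointWedge (z.1 L) = {π z}) : IsProperMap π := by
  refine isProperMap_iff_ultrafilter.2 ⟨hπ, fun 𝒰 x hx => ?_⟩
  have hmem : ∀ z L, ∀ v ∈ (z.1 L).coord.support, π z ∈ v.wedge := fun z =>
    mem_iInter_pointWedge.1 (h z ▸ rfl)
  choose w hw hlim using fun L => Realization.exists_tendsto_of_mem_simplex 𝒰
    (hA.vertices_mem_faces x L) (hA.eventually_mem_simplex hx fun z => hmem z L)
  let z : NerveLimit A := ⟨w, fun L M hLM => by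
    -- The levelwise limits form a thread because bonding maps are continuous and realizations are
    -- Hausdorff.
    refine tendsto_nhds_unique ?_ (hlim L)
    refine (((Realization.continuous_map (hf := proj_simplicial_nerve hLM)).tendsto _).comp
      (hlim M)).congr fun z => z.2 L M hLM⟩
  refine ⟨z, ?_, ?_⟩
  -- The limit at each level stays in the closed simplex `vertices x L`, so `x` lies in all its
  -- wedges.
  · have hz : x ∈ ⋂ L : Finset A, pointWedge (z.1 L) :=
      mem_iInter_pointWedge.2 fun L => hA.mem_simplex_vertices.1 (hw L)
    rw [h z] at hz
    exact hz.symm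
  · exact tendsto_id'.1 (tendsto_subtype_rng.2 (tendsto_pi_nhds.2 hlim))

end IsLocallyFiniteSystem

/-! ### Canonical maps from partitions of unity. -/

theorem SubordinateTo.mem {α : Set (Set X)} {φ : PartitionOfUnity α X} (h : SubordinateTo α φ)
    {V : α} {x : X} (hx : φ V x ≠ 0) : x ∈ (V : Set X) :=
  interior_subset (h V (subset_tsupport _ hx))

/-- The product of the functions of the partitions of unity along a vertex. -/
def vertexWeight (Φ : ∀ α : A, PartitionOfUnity (α : Set (Set X)) X) (x : X) {L : Finset A}
    (v : Vertex A L) : ℝ :=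
  ∏ α : L, Φ α.1 (v.choice α) x

section Weight

variable {Φ : ∀ α : A, PartitionOfUnity (α : Set (Set X)) X} {x : X} {L M : Finset A}

theorem vertexWeight_nonneg (v : Vertex A L) : 0 ≤ vertexWeight Φ x v :=
  Finset.prod_nonneg fun α _ => (Φ α.1).nonneg _ x

theorem continuous_vertexWeight (v : Vertex A L) : Continuous fun x => vertexWeight Φ x v :=
  continuous_finsetProd _ fun α _ => (Φ α.1 (v.choice α)).continuous

variable (hΦ : ∀ α : A, SubordinateTo (α : Set (Set X)) (Φ α))
include hΦ

theorem mem_wedge_of_vertexWeight_ne_zero {v : Vertex A L} (h : vertexWeight Φ x v ≠ 0) :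
    x ∈ v.wedge :=
  Vertex.mem_wedge.2 fun α => (hΦ α.1).mem (Finset.prod_ne_zero_iff.1 h α (Finset.mem_univ α))

/-- Distributivity: choices that are not vertices in `s` contribute zero, since a nonzero product
forces `x` into every chosen member. The sets `t α` are left free so that one formula yields both
the total weight and the sums over fibres of `Vertex.proj`. -/
theorem sum_vertexWeight {s : Finset (Vertex A L)}
    (t : ∀ α : L, Finset (α.1.1 : Set (Set X)))
    (hs : ∀ v, v ∈ s ↔ x ∈ v.wedge ∧ ∀ α, v.choice α ∈ t α) :
    ∑ v ∈ s, vertexWeight Φ x v = ∏ α, ∑ V ∈ t α, Φ α.1 V x := by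
  classical
  rw [Finset.prod_univ_sum]
  refine Finset.sum_bij_ne_zero (fun v _ _ => v.choice)
    (fun v hv _ => Fintype.mem_piFinset.2 ((hs v).1 hv).2) (fun _ _ _ _ _ _ => Vertex.ext)
    (fun c hc hne => ?_) (fun _ _ _ => rfl)
  have hx : x ∈ ⋂ α : L, (c α : Set X) := Set.mem_iInter.2 fun α =>
    (hΦ α.1).mem (Finset.prod_ne_zero_iff.1 hne α (Finset.mem_univ α))
  exact ⟨⟨c, x, hx⟩, (hs _).2 ⟨hx, Fintype.mem_piFinset.1 hc⟩, hne, rfl⟩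

theorem sum_partition_eq_one {α : A} {t : Finset (α : Set (Set X))}
    (ht : ∀ V, V ∈ t ↔ x ∈ (V : Set X)) : ∑ V ∈ t, Φ α V x = 1 := by
  rw [← (Φ α).sum_eq_one (Set.mem_univ x)]
  exact (finsum_eq_sum_of_support_subset _ fun V hV => (ht V).2 ((hΦ α).mem hV)).symm

variable (hA : IsLocallyFiniteSystem A)
include hA

theorem sum_vertices_vertexWeight : ∑ v ∈ hA.vertices x L, vertexWeight Φ x v = 1 := by
  choose t ht using hA.exists_finset_mem x
  rw [sum_vertexWeight hΦ (fun α => t α.1) fun v => ?_]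
  · exact Finset.prod_eq_one fun α _ => sum_partition_eq_one hΦ (ht _)
  · rw [hA.mem_vertices]
    exact ⟨fun h => ⟨h, fun α => (ht _ _).2 (Vertex.mem_wedge.1 h α)⟩, And.left⟩

theorem sum_proj_vertexWeight [DecidableEq (Vertex A L)] (h : L ≤ M) (w : Vertex A L) :
    ∑ v ∈ hA.vertices x M with v.proj h = w, vertexWeight Φ x v = vertexWeight Φ x w := by
  classical
  choose t ht using hA.exists_finset_mem x
  -- Coordinates in `L` are frozen at those of `w`; the others run over all members containing `x`,
  -- and their sums equal `1`.
  let T : ∀ α : A, Finset (α : Set (Set X)) := fun α =>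
    if hα : α ∈ L then {w.choice ⟨α, hα⟩} else t α
  rw [sum_vertexWeight hΦ (fun α => T α.1) fun v => ?_]
  · rw [Finset.prod_coe_sort M fun α => ∑ V ∈ T α, Φ α V x, vertexWeight,
      ← Finset.prod_subset h fun α _ hα => ?_, ← Finset.prod_coe_sort L]
    · refine Finset.prod_congr rfl fun α _ => ?_
      simp only [T, dif_pos α.2, Finset.sum_singleton]
    · simp only [T, dif_neg hα]
      exact sum_partition_eq_one hΦ (ht _)
  · rw [Finset.mem_filter, hA.mem_vertices]
    refine and_congr_right fun hx => ⟨?_, fun hv => ?_⟩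
    · rintro rfl α
      by_cases hα : α.1 ∈ L
      · simp only [T, dif_pos hα, Finset.mem_singleton]
        rfl
      · simp only [T, dif_neg hα]
        exact (ht _ _).2 (Vertex.mem_wedge.1 hx α)
    · refine Vertex.ext (funext fun α => ?_)
      have := hv ⟨α.1, h α.2⟩
      simp only [T, dif_pos α.2, Finset.mem_singleton] at this
      exact this

/-- The limit of the canonical maps. -/
noncomputable def canonicalPoint (x : X) : NerveLimit A :=
  ⟨fun L => Realization.ofFace (hA.vertices x L) (hA.vertices_mem_faces x L) (vertexWeight Φ x)
    vertexWeight_nonneg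
    (fun _ hv => hA.mem_vertices.2 (mem_wedge_of_vertexWeight_ne_zero hΦ hv))
    (sum_vertices_vertexWeight hΦ hA), fun L M h => by
      classical
      refine Realization.ext (Finsupp.ext fun w => ?_)
      exact (Realization.map_coord_apply (Realization.ofFace_mem_simplex ..) w).trans
        (sum_proj_vertexWeight hΦ hA h w)⟩

theorem canonicalPoint_coord (v : Vertex A L) :
    ((canonicalPoint hΦ hA x).1 L).coord v = vertexWeight Φ x v := rfl

theorem mem_wedge_of_mem_support_canonicalPoint {v : Vertex A L}
    (hv : v ∈ ((canonicalPoint hΦ hA x).1 L).coord.support) : x ∈ v.wedge :=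
  mem_wedge_of_vertexWeight_ne_zero hΦ (Finsupp.mem_support_iff.1 hv)

theorem continuous_canonicalPoint : Continuous (canonicalPoint hΦ hA) :=
  hA.continuous_of_coord continuous_id
    (fun _ _ _ => mem_wedge_of_mem_support_canonicalPoint hΦ hA)
    fun _ v => continuous_vertexWeight v

end Weight

/-! ### Straight-line homotopies within fibres. -/

/-- The thread of the points dividing the segments between two threads in a given ratio. -/
noncomputable def segmentPoint (hA : IsLocallyFiniteSystem A) {x : X} (t : unitInterval)
    (y z : NerveLimit A)
    (hy : ∀ L, y.1 L ∈ Realization.simplex (nerveComplex A L) (hA.vertices x L))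
    (hz : ∀ L, z.1 L ∈ Realization.simplex (nerveComplex A L) (hA.vertices x L)) :
    NerveLimit A :=
  ⟨fun L => Realization.ofFace (hA.vertices x L) (hA.vertices_mem_faces x L)
    (fun v => (1 - t : ℝ) * (y.1 L).coord v + t * (z.1 L).coord v)
    (fun v => add_nonneg (mul_nonneg (unitInterval.one_minus_nonneg t) ((y.1 L).nonneg v))
      (mul_nonneg (unitInterval.nonneg t) ((z.1 L).nonneg v)))
    (fun v => by
      refine not_imp_comm.1 fun hv => ?_
      rw [Realization.coord_eq_zero_of_mem_simplex (hy L) hv,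
        Realization.coord_eq_zero_of_mem_simplex (hz L) hv, mul_zero, mul_zero, add_zero])
    (by
      rw [Finset.sum_add_distrib, ← Finset.mul_sum, ← Finset.mul_sum,
        Realization.sum_coord_of_mem_simplex (hy L), Realization.sum_coord_of_mem_simplex (hz L)]
      ring), fun L M h => by
    classical
    refine Realization.ext (Finsupp.ext fun w => ?_)
    refine (Realization.map_coord_apply (Realization.ofFace_mem_simplex ..) w).trans ?_
    simp only [Realization.ofFace_coord]
    -- Bonding maps are affine on a simplex, so they commute with taking convex combinations.
    rw [Finset.sum_add_distrib, ← Finset.mul_sum, ← Finset.mul_sum, ← y.2 L M h, ← z.2 L M h,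
      nerveBond, Realization.map_coord_apply (hy M), Realization.map_coord_apply (hz M)]⟩

section Homotopy

variable (hA : IsLocallyFiniteSystem A) {π : NerveLimit A → X} {p : NerveLimit A → NerveLimit A}
  (hπ : ∀ z L, ∀ v ∈ (z.1 L).coord.support, π z ∈ v.wedge)
  (hp : ∀ z L, ∀ v ∈ ((p z).1 L).coord.support, π z ∈ v.wedge)

/-- The straight-line homotopy between the identity and a map that moves every thread within the
simplices around a common point. -/
noncomputable def straightLine (q : unitInterval × NerveLimit A) : NerveLimit A :=
  segmentPoint hA q.1 q.2 (p q.2) (fun L => hA.mem_simplex_vertices.2 (hπ q.2 L))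
    (fun L => hA.mem_simplex_vertices.2 (hp q.2 L))

theorem mem_wedge_of_mem_support_straightLine (q : unitInterval × NerveLimit A) (L : Finset A) :
    ∀ v ∈ ((straightLine hA hπ hp q).1 L).coord.support, π q.2 ∈ v.wedge := by
  refine fun v hv => not_not.1 fun hx => Finsupp.mem_support_iff.1 hv ?_
  have hy : (q.2.1 L).coord v = 0 := Finsupp.notMem_support_iff.1 fun h => hx (hπ _ _ _ h)
  have hz : ((p q.2).1 L).coord v = 0 := Finsupp.notMem_support_iff.1 fun h => hx (hp _ _ _ h)
  change (1 - q.1 : ℝ) * (q.2.1 L).coord v + q.1 * ((p q.2).1 L).coord v = 0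
  rw [hy, hz, mul_zero, mul_zero, add_zero]

theorem straightLine_coord (q : unitInterval × NerveLimit A) (L : Finset A) (v : Vertex A L) :
    ((straightLine hA hπ hp q).1 L).coord v =
      (1 - q.1 : ℝ) * (q.2.1 L).coord v + q.1 * ((p q.2).1 L).coord v := rfl

theorem continuous_straightLine (hπc : Continuous π) (hpc : Continuous p) :
    Continuous (straightLine hA hπ hp) := by
  refine hA.continuous_of_coord (hπc.comp continuous_snd)
    (mem_wedge_of_mem_support_straightLine hA hπ hp) fun L v => ?_
  simp only [straightLine_coord]
  have h := continuous_nerveLimit_coord (A := A) L v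
  exact ((continuous_const.sub (continuous_subtype_val.comp continuous_fst)).mul
    (h.comp continuous_snd)).add ((continuous_subtype_val.comp continuous_fst).mul
      (h.comp (hpc.comp continuous_snd)))

theorem straightLine_zero (z : NerveLimit A) : straightLine hA hπ hp (0, z) = z := by
  refine Subtype.ext (funext fun L => Realization.ext (Finsupp.ext fun v => ?_))
  simp [straightLine_coord]

theorem straightLine_one (z : NerveLimit A) : straightLine hA hπ hp (1, z) = p z := by
  refine Subtype.ext (funext fun L => Realization.ext (Finsupp.ext fun v => ?_))
  simp [straightLine_coord]

end Homotopy

/-- A fibre of a map with a section, in which the section is joined to the identity by a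
fibrewise homotopy, is contractible. -/
theorem contractibleSpace_fiber {E B : Type*} [TopologicalSpace E] [TopologicalSpace B]
    {π : C(E, B)} {p : C(B, E)} (hp : π.comp p = ContinuousMap.id B)
    (H : ContinuousMap.Homotopy (ContinuousMap.id E) (p.comp π))
    (hH : ∀ t z, π (H (t, z)) = π z) (x : B) : ContractibleSpace (π ⁻¹' {x}) := by
  have hmem : p x ∈ π ⁻¹' {x} := DFunLike.congr_fun hp x
  refine (contractible_iff_id_nullhomotopic _).2 ⟨⟨p x, hmem⟩, ⟨?_⟩⟩
  exact
    { toFun := fun q => ⟨H (q.1, q.2.1), (hH q.1 q.2.1).trans q.2.2⟩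
      continuous_toFun := Continuous.subtype_mk (H.continuous.comp
        (continuous_fst.prodMk (continuous_subtype_val.comp continuous_snd))) _
      map_zero_left := fun z => Subtype.ext (H.apply_zero z.1)
      map_one_left := fun z => Subtype.ext <| (H.apply_one z.1).trans <|
        congrArg p z.2 }

end CoverLimit

/-! ### Assembly of the theorem. -/

open CoverLimit in
theorem theorem2p5 {X : Type*} [TopologicalSpace X] (hX : CoverLimit.TopologicallyComplete X)
    (A : Set (Set (Set X))) (hA : ∀ α ∈ A, CoverLimit.IsClosedNormalCover α)
    (hI : CoverLimit.LocalRefinement A) (hII : CoverLimit.SelectionComplete A) :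
    -- `N_∞ = F_∞`
    IsHomeomorph (CoverLimit.limitIncl A) ∧
    -- the intersection of the `∧z(λ)` is a single point for each thread of either system
    (∀ z : CoverLimit.FlagLimit A, ∃ x : X,
      ⋂ L : Finset A, CoverLimit.pointWedge (z.1 L) = {x}) ∧
    ∃ π : C(CoverLimit.NerveLimit A, X),
      (∀ z, ⋂ L : Finset A, CoverLimit.pointWedge (z.1 L) = {π z}) ∧
      CoverLimit.IsPerfectMap π ∧
      (∀ Φ : ∀ α : A, PartitionOfUnity (α : Set (Set X)) X,
        (∀ α : A, CoverLimit.SubordinateTo (α : Set (Set X)) (Φ α)) →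
        ∃ p : C(X, CoverLimit.NerveLimit A),
          CoverLimit.IsLimitOfCanonicalMaps Φ p ∧
          π.comp p = ContinuousMap.id X ∧
          (∃ H : ContinuousMap.Homotopy (ContinuousMap.id (CoverLimit.NerveLimit A)) (p.comp π),
            ∀ t z, π (H (t, z)) = π z) ∧
          ∃ e : ContinuousMap.HomotopyEquiv (CoverLimit.NerveLimit A) X,
            e.toFun = π ∧ e.invFun = p) ∧
      ∀ x : X, ContractibleSpace (π ⁻¹' {x}) := by
  have : T35Space X := hX.tychonoff
  have hS : IsLocallyFiniteSystem A := ⟨fun α hα => (hA α hα).cover,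
    fun α hα => (hA α hα).closed, fun α hα => (hA α hα).locallyFinite⟩
  have hpt : ∀ z : FlagLimit A, ∃ x : X, ⋂ L : Finset A, pointWedge (z.1 L) = {x} :=
    FlagLimit.iInter_pointWedge hS.closed hI hII
  choose q hq using hpt
  have hqw : ∀ z L, ∀ v ∈ (z.1 L).coord.support, q z ∈ v.wedge := fun z =>
    mem_iInter_pointWedge.1 (hq z ▸ rfl)
  have hqc : Continuous q := hI.continuous continuous_subtype_val hqw
  let π : C(NerveLimit A, X) := ⟨q ∘ limitIncl A, hqc.comp continuous_limitIncl⟩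
  have hπ : ∀ z, ⋂ L : Finset A, pointWedge (z.1 L) = {π z} := fun z => hq (limitIncl A z)
  have hπw : ∀ (z : NerveLimit A) L, ∀ v ∈ (z.1 L).coord.support, π z ∈ v.wedge := fun z =>
    hqw (limitIncl A z)
  have hprop : IsProperMap π := hS.isProperMap π.continuous hπ
  have hmap : ∀ Φ : ∀ α : A, PartitionOfUnity (α : Set (Set X)) X,
      (∀ α : A, SubordinateTo (α : Set (Set X)) (Φ α)) →
      ∃ p : C(X, NerveLimit A), IsLimitOfCanonicalMaps Φ p ∧ π.comp p = ContinuousMap.id X ∧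
        ∃ H : ContinuousMap.Homotopy (ContinuousMap.id (NerveLimit A)) (p.comp π),
          ∀ t z, π (H (t, z)) = π z := by
    intro Φ hΦ
    let p : C(X, NerveLimit A) := ⟨canonicalPoint hΦ hS, continuous_canonicalPoint hΦ hS⟩
    have hp : ∀ x L, ∀ v ∈ ((p x).1 L).coord.support, x ∈ v.wedge := fun x L v =>
      mem_wedge_of_mem_support_canonicalPoint hΦ hS
    have hp' : ∀ z L, ∀ v ∈ ((p.comp π z).1 L).coord.support, π z ∈ v.wedge := fun z => hp (π z)
    -- Both `x` and `π (p x)` lie in every wedge of the thread `p x`, so they coincide. The same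
    -- uniqueness shows that the homotopy preserves fibres.
    refine ⟨p, fun x L v => canonicalPoint_coord hΦ hS v, ContinuousMap.ext fun x =>
      hI.eq_of_forall_mem_wedge (hπw (p x)) (hp x), ⟨⟨straightLine hS hπw hp',
      continuous_straightLine hS hπw hp' π.continuous (p.comp π).continuous⟩,
      straightLine_zero hS hπw hp', straightLine_one hS hπw hp'⟩, fun t z => ?_⟩
    exact hI.eq_of_forall_mem_wedge (hπw _)
      (mem_wedge_of_mem_support_straightLine hS hπw hp' (t, z))
  refine ⟨?_, fun z => ⟨q z, hq z⟩, π, hπ, ⟨inferInstance, π.continuous, hprop.isClosedMap,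
    fun x => hprop.isCompact_preimage isCompact_singleton⟩, fun Φ hΦ => ?_, fun x => ?_⟩
  -- `π = q ∘ limitIncl A` is proper and `FlagLimit A` is Hausdorff, so `limitIncl A` is itself
  -- proper, hence closed.
  · exact isHomeomorph_iff_continuous_isClosedMap_bijective.2 ⟨continuous_limitIncl,
      (isProperMap_of_comp_of_t2 continuous_limitIncl hqc hprop).isClosedMap,
      limitIncl_injective, limitIncl_surjective hqw⟩
  · obtain ⟨p, hlim, hp, H, hH⟩ := hmap Φ hΦ
    exact ⟨p, hlim, hp, ⟨H, hH⟩, ⟨π, p, ⟨H.symm⟩, hp ▸ ContinuousMap.Homotopic.refl _⟩, rfl, rfl⟩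
  · choose Φ hΦ using fun α : A => (hA α α.2).normal
    obtain ⟨p, -, hp, H, hH⟩ := hmap Φ hΦ
    exact contractibleSpace_fiber hp H hH x
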